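/- Let $G=\langle A\mid R\rangle$ be a finite group presentation, with Dehn function $f:\mathbb N\to\mathbb N$. Here $f(n)$ is the maximum, over all words $w$ of length at most $n$ in the letters $A\cup A^{-1}$ that represent $1$ in $G$, of the area of $w$, that is, of the least $m$ such that $w$ is equal, in the free group on $A$, to a product of $m$ conjugates of elements of $R\cup R^{-1}$. Suppose that $f$ has the following property with respect to an increasing (not necessarily strictly) sequence of natural numbers $n_i\to\infty$. (P2) $f(n_i)/n_i^2\to\infty$, and there are constants $c'>0$ and $c$ such that $f(n)\le c\,n_i^2$ for every $i$ and every integer $n\ge 0$ with $n\le c'n_i$. Then for every non-principal ultrafilter $\omega$ on $\mathbb N$ and every base point $x_0\in G$, the asymptotic cone $\mathrm{Con}^\omega(G,(n_i))$ is not simply connected; more precisely, it contains a loop that is not contractible. Here $G$ carries the word metric with respect to $A$, and $\mathrm{Con}^\omega(G,(n_i))$ is the set of all sequences $g:\mathbb N\to G$ such that, for some constant $C=C(g)$, $\mathrm{dist}(g(i),x_0)\le C n_i$ for all $i$, modulo the relation $g\sim h\iff\lim_\omega \mathrm{dist}(g(i),h(i))/n_i=0$, with the metric $\mathrm{dist}([g],[h])=\lim_\omega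 \mathrm{dist}(g(i),h(i))/n_i$. -/

import Mathlib

open Filter Topology
open scoped NNReal

namespace GroupCone

noncomputable section

/-! ### Finite presentations: area and Dehn function -/

/-- `IsRelatorProduct R m w`: in the free group, `w` is a product of `m` conjugates of elements
of `R` and of inverses of elements of `R`. -/
def IsRelatorProduct {α : Type*} (R : Set (FreeGroup α)) (m : ℕ) (w : FreeGroup α) : Prop :=
  ∃ l : List (FreeGroup α), l.length = m ∧
    (∀ x ∈ l, ∃ g : FreeGroup α, ∃ r ∈ R, x = g * r * g⁻¹ ∨ x = g * r⁻¹ * g⁻¹) ∧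
    l.prod = w

/-- The area of `w` over the relators `R`: the least `m` such that `w` is a product of `m`
conjugates of elements of `R ∪ R⁻¹` (used for `w` trivial in the presented group). -/
def area {α : Type*} (R : Set (FreeGroup α)) (w : FreeGroup α) : ℕ :=
  sInf {m | IsRelatorProduct R m w}

/-- The element of the presented group that is represented by a word in the letters `a`, `a⁻¹`
(the letter `(a, true)` stands for `a`, the letter `(a, false)` for `a⁻¹`). -/
def wordValue {α : Type*} (R : Set (FreeGroup α)) (w : List (α × Bool)) : PresentedGroup R :=
  PresentedGroup.mk R (FreeGroup.mk w)

/-- The Dehn function of the presentation `⟨α | R⟩`: the maximum of the areas of the words of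
length at most `n` that represent the identity. It is a maximum when `α` is finite, see
`dehnFunction_isGreatest`. -/
def dehnFunction {α : Type*} (R : Set (FreeGroup α)) (n : ℕ) : ℕ :=
  sSup {m | ∃ w : List (α × Bool),
    w.length ≤ n ∧ wordValue R w = 1 ∧ m = area R (FreeGroup.mk w)}

/-- A word that represents the identity is a product of conjugates of relators, so that its area
is attained. -/
theorem isRelatorProduct_area {α : Type*} (R : Set (FreeGroup α)) (w : List (α × Bool))
    (hw : wordValue R w = 1) :
    IsRelatorProduct R (area R (FreeGroup.mk w)) (FreeGroup.mk w) := by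
  have hmem : FreeGroup.mk w ∈ Subgroup.normalClosure R := by
    rw [← PresentedGroup.mk_eq_one_iff]; exact hw
  refine Nat.sInf_mem (s := {m | IsRelatorProduct R m (FreeGroup.mk w)}) ?_
  generalize FreeGroup.mk w = x at hmem
  unfold Subgroup.normalClosure at hmem
  rw [← Subgroup.mem_toSubmonoid, Subgroup.closure_toSubmonoid] at hmem
  obtain ⟨l, hl, rfl⟩ := Submonoid.exists_list_of_mem_closure hmem
  refine ⟨l.length, l, rfl, fun x hx => ?_, rfl⟩
  rcases hl x hx with h | h
  · obtain ⟨r, hr, hc⟩ := Group.mem_conjugatesOfSet_iff.1 h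
    obtain ⟨g, rfl⟩ := isConj_iff.1 hc
    exact ⟨g, r, hr, Or.inl rfl⟩
  · obtain ⟨r, hr, hc⟩ := Group.mem_conjugatesOfSet_iff.1 h
    obtain ⟨g, hg⟩ := isConj_iff.1 hc
    refine ⟨g, r, hr, Or.inr ?_⟩
    rw [← inv_inj, ← hg]
    group

/-- Over a finite alphabet the supremum in the definition of the Dehn function is attained. -/
theorem dehnFunction_isGreatest {α : Type*} [Finite α] (R : Set (FreeGroup α)) (n : ℕ) :
    IsGreatest {m | ∃ w : List (α × Bool),
      w.length ≤ n ∧ wordValue R w = 1 ∧ m = area R (FreeGroup.mk w)} (dehnFunction R n) := by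
  have hfin : {m | ∃ w : List (α × Bool),
      w.length ≤ n ∧ wordValue R w = 1 ∧ m = area R (FreeGroup.mk w)}.Finite := by
    refine ((List.finite_length_le (α × Bool) n).image
      (fun w => area R (FreeGroup.mk w))).subset ?_
    rintro m ⟨w, hw, -, rfl⟩
    exact ⟨w, hw, rfl⟩
  have hne : {m | ∃ w : List (α × Bool),
      w.length ≤ n ∧ wordValue R w = 1 ∧ m = area R (FreeGroup.mk w)}.Nonempty :=
    ⟨_, [], Nat.zero_le _, map_one (PresentedGroup.mk R), rfl⟩
  exact ⟨Nat.sSup_mem hne hfin.bddAbove, fun m hm => le_csSup hfin.bddAbove hm⟩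

/-! ### The word metric -/

/-- The word length of a group element: the least length of a word that represents it. -/
def wordLength {α : Type*} (R : Set (FreeGroup α)) (g : PresentedGroup R) : ℕ :=
  sInf {m | ∃ w : List (α × Bool), w.length = m ∧ wordValue R w = g}

theorem exists_word {α : Type*} (R : Set (FreeGroup α)) (g : PresentedGroup R) :
    ∃ w : List (α × Bool), w.length = wordLength R g ∧ wordValue R w = g := by
  refine Nat.sInf_mem (s := {m | ∃ w : List (α × Bool), w.length = m ∧ wordValue R w = g}) ?_
  obtain ⟨x, rfl⟩ := PresentedGroup.mk_surjective R g
  obtain ⟨w, rfl⟩ := Quot.exists_rep x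
  exact ⟨w.length, w, rfl, rfl⟩

theorem wordLength_le {α : Type*} (R : Set (FreeGroup α)) (w : List (α × Bool)) :
    wordLength R (wordValue R w) ≤ w.length :=
  Nat.sInf_le ⟨w, rfl, rfl⟩

theorem wordLength_one {α : Type*} (R : Set (FreeGroup α)) : wordLength R 1 = 0 :=
  Nat.le_zero.1 (wordLength_le R [])

theorem wordLength_mul_le {α : Type*} (R : Set (FreeGroup α)) (g h : PresentedGroup R) :
    wordLength R (g * h) ≤ wordLength R g + wordLength R h := by
  obtain ⟨u, hu, hug⟩ := exists_word R g
  obtain ⟨v, hv, hvh⟩ := exists_word R h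
  have key : wordValue R (u ++ v) = g * h := by
    rw [← hug, ← hvh, wordValue, wordValue, wordValue, ← FreeGroup.mul_mk, map_mul]
  rw [← key, ← hu, ← hv, ← List.length_append]
  exact wordLength_le R _

theorem wordLength_inv_le {α : Type*} (R : Set (FreeGroup α)) (g : PresentedGroup R) :
    wordLength R g⁻¹ ≤ wordLength R g := by
  obtain ⟨u, hu, hug⟩ := exists_word R g
  have key : wordValue R (FreeGroup.invRev u) = g⁻¹ := by
    rw [← hug, wordValue, wordValue, ← FreeGroup.inv_mk, map_inv]
  rw [← key, ← hu, ← FreeGroup.invRev_length (L₁ := u)]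
  exact wordLength_le R _

/-- The word metric of the presented group with respect to its generators:
`dist g h` is the word length of `g⁻¹ * h`. -/
instance wordMetric {α : Type*} (R : Set (FreeGroup α)) : MetricSpace (PresentedGroup R) where
  dist g h := (wordLength R (g⁻¹ * h) : ℝ)
  dist_self g := by rw [inv_mul_cancel, wordLength_one, Nat.cast_zero]
  dist_comm g h := by
    have key : ∀ a b : PresentedGroup R, wordLength R (a⁻¹ * b) ≤ wordLength R (b⁻¹ * a) := by
      intro a b
      have := wordLength_inv_le R (b⁻¹ * a)
      rwa [mul_inv_rev, inv_inv] at this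
    exact congrArg Nat.cast (le_antisymm (key g h) (key h g))
  dist_triangle g h k := by
    have := wordLength_mul_le R (g⁻¹ * h) (h⁻¹ * k)
    rw [mul_assoc, mul_inv_cancel_left] at this
    exact_mod_cast this
  eq_of_dist_eq_zero {g h} hgh := by
    have h0 : wordLength R (g⁻¹ * h) = 0 := Nat.cast_eq_zero.1 hgh
    obtain ⟨w, hw, hwg⟩ := exists_word R (g⁻¹ * h)
    rw [h0, List.length_eq_zero_iff] at hw
    subst hw
    exact inv_mul_eq_one.1 (hwg.symm.trans (map_one (PresentedGroup.mk R)))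

theorem dist_eq_wordLength {α : Type*} (R : Set (FreeGroup α)) (g h : PresentedGroup R) :
    dist g h = (wordLength R (g⁻¹ * h) : ℝ) := rfl

/-! ### Asymptotic cones -/

/-- An ultrafilter on `ℕ` is non-principal if finite sets have measure zero. -/
def NonPrincipal (ω : Ultrafilter ℕ) : Prop := ∀ s : Set ℕ, s.Finite → s ∉ ω

/-- The sequences in `X` whose distance to the base point `x₀` is at most a constant times the
scaling constants `d i`. The ultrafilter is a parameter because it determines the distance. -/
def ConeSeq {X : Type*} [PseudoMetricSpace X] (_ω : Ultrafilter ℕ) (d : ℕ → ℝ≥0) (x₀ : X) :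
    Type _ :=
  {f : ℕ → X // ∃ c : ℝ, ∀ i, dist (f i) x₀ ≤ c * (d i : ℝ)}

/-- The limit along `ω` of the rescaled distances of two sequences. -/
def ConeSeq.limDist {X : Type*} [PseudoMetricSpace X] {ω : Ultrafilter ℕ} {d : ℕ → ℝ≥0} {x₀ : X}
    (f g : ConeSeq ω d x₀) : ℝ :=
  limUnder (ω : Filter ℕ) fun i => dist (f.1 i) (g.1 i) / (d i : ℝ)

/-- The limit in the definition of `ConeSeq.limDist` exists. -/
theorem ConeSeq.tendsto_limDist {X : Type*} [PseudoMetricSpace X] {ω : Ultrafilter ℕ}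
    {d : ℕ → ℝ≥0} {x₀ : X} (f g : ConeSeq ω d x₀) :
    Tendsto (fun i => dist (f.1 i) (g.1 i) / (d i : ℝ)) (ω : Filter ℕ) (𝓝 (f.limDist g)) := by
  obtain ⟨a, ha⟩ := f.2
  obtain ⟨b, hb⟩ := g.2
  have hmem : ∀ i, dist (f.1 i) (g.1 i) / (d i : ℝ) ∈ Set.Icc (0 : ℝ) (|a| + |b|) := by
    intro i
    refine ⟨by positivity, div_le_of_le_mul₀ (d i).2 (by positivity) ?_⟩
    have h1 := dist_triangle_right (f.1 i) (g.1 i) x₀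
    have h2 : a * (d i : ℝ) ≤ |a| * (d i : ℝ) := mul_le_mul_of_nonneg_right (le_abs_self a) (d i).2
    have h3 : b * (d i : ℝ) ≤ |b| * (d i : ℝ) := mul_le_mul_of_nonneg_right (le_abs_self b) (d i).2
    linarith [ha i, hb i]
  obtain ⟨l, -, hl⟩ := (isCompact_Icc (a := (0 : ℝ)) (b := |a| + |b|)).ultrafilter_le_nhds
    (ω.map fun i => dist (f.1 i) (g.1 i) / (d i : ℝ))
    (le_principal_iff.2 (Filter.mem_map.2 (Filter.univ_mem' hmem)))
  exact tendsto_nhds_limUnder ⟨l, hl⟩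

instance ConeSeq.pseudoMetricSpace {X : Type*} [PseudoMetricSpace X] (ω : Ultrafilter ℕ)
    (d : ℕ → ℝ≥0) (x₀ : X) : PseudoMetricSpace (ConeSeq ω d x₀) where
  dist f g := f.limDist g
  dist_self f := by
    refine tendsto_nhds_unique (f.tendsto_limDist f) ?_
    have h0 : (fun i => dist (f.1 i) (f.1 i) / (d i : ℝ)) = fun _ => 0 :=
      funext fun i => by rw [dist_self, zero_div]
    rw [h0]
    exact tendsto_const_nhds
  dist_comm f g := by
    refine tendsto_nhds_unique (f.tendsto_limDist g) ?_
    have h0 : (fun i => dist (f.1 i) (g.1 i) / (d i : ℝ)) =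
        fun i => dist (g.1 i) (f.1 i) / (d i : ℝ) :=
      funext fun i => by rw [dist_comm]
    rw [h0]
    exact g.tendsto_limDist f
  dist_triangle f g h := by
    refine le_of_tendsto_of_tendsto' (f.tendsto_limDist h)
      ((f.tendsto_limDist g).add (g.tendsto_limDist h)) fun i => ?_
    rw [← add_div]
    exact div_le_div_of_nonneg_right (dist_triangle _ _ _) (d i).2

/-- The asymptotic cone `Con^ω(X, (d i))`: sequences at limit distance `0` are identified, and
the distance of two classes is the limit distance. -/
abbrev AsymptoticCone {X : Type*} [PseudoMetricSpace X] (ω : Ultrafilter ℕ) (d : ℕ → ℝ≥0)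
    (x₀ : X) : Type _ :=
  SeparationQuotient (ConeSeq ω d x₀)

theorem AsymptoticCone.tendsto_dist {X : Type*} [PseudoMetricSpace X] {ω : Ultrafilter ℕ}
    {d : ℕ → ℝ≥0} {x₀ : X} (f g : ConeSeq ω d x₀) :
    Tendsto (fun i => dist (f.1 i) (g.1 i) / (d i : ℝ)) (ω : Filter ℕ)
      (𝓝 (dist (SeparationQuotient.mk f : AsymptoticCone ω d x₀) (SeparationQuotient.mk g))) :=
  f.tendsto_limDist g

/-! ### The growth condition -/

/-- Property (P2) of a function `f` with respect to the sequence `n i`: the sequence is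
increasing and tends to infinity, `f (n i) / (n i)²` tends to infinity, and, for some constants
`c' > 0` and `c`, `f m ≤ c (n i)²` for every `i` and every integer `m ≤ c' * n i`. -/
def PropertyP2 (f : ℕ → ℕ) (n : ℕ → ℕ) : Prop :=
  Monotone n ∧ Tendsto n atTop atTop ∧
  Tendsto (fun i => (f (n i) : ℝ) / (n i : ℝ) ^ 2) atTop atTop ∧
  ∃ c' : ℝ, 0 < c' ∧ ∃ c : ℝ, ∀ i m : ℕ, (m : ℝ) ≤ c' * (n i : ℝ) →
    (f m : ℝ) ≤ c * (n i : ℝ) ^ 2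

end

end GroupCone

/-!
Suppose that every loop of the cone is contractible. For each `i` choose a word `w i` of length at
most `n i` that represents `1` and has the maximal area `f (n i)`. The rescaled prefixes of the
words `w i` converge to a loop `prefixLoop` of the cone, which is `1`-Lipschitz.

A null homotopy of this loop is a uniformly continuous map of the unit square, so it maps the cells
of a sufficiently fine `N × N` grid to sets of small diameter. Lifting the vertices of the grid to
sequences in the group and joining neighbours by geodesic words (by subwords of `w i` on the side
of the square that carries the loop), one obtains for `ω`-almost all `i` a
subdivision of `w i` into `N²` loops of length at most `c' * n i` (`exists_areaLE_of_homotopic`).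
Hence `f (n i) ≤ N² * f ⌊c' * n i⌋ ≤ N² * c * (n i)²`. Here `N` does not depend on `i`,
which contradicts `f (n i) / (n i)² → ∞`.

The combinatorial part, that the area of the boundary of a grid is at most the sum of the areas of
its cells, is `AreaLE.grid`.
-/

namespace GroupCone

noncomputable section

/-! ### Area of products and of grids -/

/-- `w` is a product of at most `m` conjugates of relators and of inverses of relators. In
contrast to `area R w ≤ m`, this fails if `w` is not trivial in the presented group. -/
def AreaLE {α : Type*} (R : Set (FreeGroup α)) (m : ℕ) (w : FreeGroup α) : Prop :=
  ∃ k ≤ m, IsRelatorProduct R k w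

section Area

variable {α : Type*} {R : Set (FreeGroup α)}

theorem AreaLE.area_le {m : ℕ} {w : FreeGroup α} (h : AreaLE R m w) : area R w ≤ m := by
  obtain ⟨k, hk, hw⟩ := h
  exact (Nat.sInf_le hw).trans hk

theorem AreaLE.one (m : ℕ) : AreaLE R m 1 :=
  ⟨0, Nat.zero_le _, [], rfl, by simp, rfl⟩

theorem AreaLE.mul {m k : ℕ} {x y : FreeGroup α} (hx : AreaLE R m x) (hy : AreaLE R k y) :
    AreaLE R (m + k) (x * y) := by
  obtain ⟨a, ha, l, rfl, hl, rfl⟩ := hx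
  obtain ⟨b, hb, l', rfl, hl', rfl⟩ := hy
  refine ⟨_, add_le_add ha hb, l ++ l', List.length_append, fun x hx => ?_, List.prod_append⟩
  exact (List.mem_append.1 hx).elim (hl x) (hl' x)

theorem AreaLE.conj {m : ℕ} {x : FreeGroup α} (hx : AreaLE R m x) (g : FreeGroup α) :
    AreaLE R m (g * x * g⁻¹) := by
  obtain ⟨a, ha, l, rfl, hl, rfl⟩ := hx
  refine ⟨_, ha, l.map (MulAut.conj g), List.length_map _, fun x hx => ?_, ?_⟩
  · obtain ⟨y, hy, rfl⟩ := List.mem_map.1 hx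
    obtain ⟨t, r, hr, h | h⟩ := hl y hy
    · exact ⟨g * t, r, hr, Or.inl (by rw [h, MulAut.conj_apply]; group)⟩
    · exact ⟨g * t, r, hr, Or.inr (by rw [h, MulAut.conj_apply]; group)⟩
  · rw [← map_list_prod, MulAut.conj_apply]

/-- The product of the first `b` labels of a sequence of edges. -/
def rowProd (h : ℕ → FreeGroup α) (b : ℕ) : FreeGroup α := ((List.range b).map h).prod

theorem rowProd_succ (h : ℕ → FreeGroup α) (b : ℕ) : rowProd h (b + 1) = rowProd h b * h b := by
  simp [rowProd, List.range_succ]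

theorem rowProd_eq_one {h : ℕ → FreeGroup α} {b : ℕ} (hh : ∀ j < b, h j = 1) :
    rowProd h b = 1 := by
  refine List.prod_eq_one fun x hx => ?_
  obtain ⟨j, hj, rfl⟩ := List.mem_map.1 hx
  exact hh j (List.mem_range.1 hj)

/-- A strip of `b` cells with bottom `h`, top `h'` and rungs `v`: its boundary is a product of
conjugates of the boundaries of the cells. -/
theorem AreaLE.strip {K : ℕ} {h h' v : ℕ → FreeGroup α} (b : ℕ)
    (hc : ∀ j < b, AreaLE R K (h j * v (j + 1) * (h' j)⁻¹ * (v j)⁻¹)) :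
    AreaLE R (b * K) (rowProd h b * v b * (rowProd h' b)⁻¹ * (v 0)⁻¹) := by
  induction b with
  | zero =>
    have : rowProd h 0 * v 0 * (rowProd h' 0)⁻¹ * (v 0)⁻¹ = 1 := by simp [rowProd]
    rw [this]
    exact AreaLE.one _
  | succ b ih =>
    have hcell := (hc b b.lt_succ_self).conj (rowProd h b)
    have hrest := ih fun j hj => hc j (hj.trans b.lt_succ_self)
    have := hcell.mul hrest
    rw [rowProd_succ, rowProd_succ, add_mul, one_mul, add_comm]
    convert this using 1
    group

/-- An `N × N` grid with horizontal edges `h a b` from `(a, b)` to `(a, b + 1)` and vertical edges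
`v a b` from `(a, b)` to `(a + 1, b)`, trivial on three sides: the area of the remaining side is
at most the sum of the areas of the cells. -/
theorem AreaLE.grid {N K : ℕ} {h v : ℕ → ℕ → FreeGroup α}
    (hc : ∀ a < N, ∀ b < N,
      AreaLE R K (h a b * v a (b + 1) * (h (a + 1) b)⁻¹ * (v a b)⁻¹))
    (hl : ∀ a < N, v a 0 = 1) (hr : ∀ a < N, v a N = 1) (ht : ∀ b < N, h N b = 1) :
    AreaLE R (N * (N * K)) (rowProd (h 0) N) := by
  have key : ∀ a ≤ N, AreaLE R (a * (N * K)) (rowProd (h 0) N * (rowProd (h a) N)⁻¹) := by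
    intro a
    induction a with
    | zero => exact fun _ => by rw [mul_inv_cancel]; exact AreaLE.one _
    | succ a ih =>
      intro ha
      have hs := AreaLE.strip N (hc a ha)
      rw [hl a ha, hr a ha, mul_one, inv_one, mul_one] at hs
      have := (ih (Nat.le_of_succ_le ha)).mul hs
      rw [add_mul, one_mul]
      convert this using 1
      group
  have := key N le_rfl
  rwa [rowProd_eq_one ht, inv_one, mul_one] at this

/-- A word that represents the identity has area at most the value of the Dehn function at any
bound of its length. -/
theorem areaLE_dehnFunction [Finite α] {w : List (α × Bool)} {m : ℕ} (hm : w.length ≤ m)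
    (hw : wordValue R w = 1) : AreaLE R (dehnFunction R m) (FreeGroup.mk w) :=
  ⟨_, (dehnFunction_isGreatest R m).2 ⟨w, hm, hw, rfl⟩, isRelatorProduct_area R w hw⟩

/-! ### Words that join group elements -/

/-- `e` is the class of a word of length at most `r` (a real number) that leads from `x` to `y` in
the Cayley graph. -/
def Joins (R : Set (FreeGroup α)) (r : ℝ) (x y : PresentedGroup R) (e : FreeGroup α) : Prop :=
  ∃ u : List (α × Bool), FreeGroup.mk u = e ∧ (u.length : ℝ) ≤ r ∧ wordValue R u = x⁻¹ * y

theorem Joins.inv {r : ℝ} {x y : PresentedGroup R} {e : FreeGroup α} (h : Joins R r x y e) :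
    Joins R r y x e⁻¹ := by
  obtain ⟨u, rfl, hu, hv⟩ := h
  refine ⟨FreeGroup.invRev u, FreeGroup.inv_mk.symm, by rwa [FreeGroup.invRev_length], ?_⟩
  rw [wordValue, ← FreeGroup.inv_mk, map_inv, ← wordValue, hv, mul_inv_rev, inv_inv]

theorem Joins.trans {r s : ℝ} {x y z : PresentedGroup R} {e e' : FreeGroup α}
    (h : Joins R r x y e) (h' : Joins R s y z e') : Joins R (r + s) x z (e * e') := by
  obtain ⟨u, rfl, hu, hv⟩ := h
  obtain ⟨u', rfl, hu', hv'⟩ := h'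
  refine ⟨u ++ u', FreeGroup.mul_mk.symm, ?_, ?_⟩
  · rw [List.length_append, Nat.cast_add]
    exact add_le_add hu hu'
  · rw [wordValue, ← FreeGroup.mul_mk, map_mul, ← wordValue, ← wordValue, hv, hv']
    group

theorem Joins.areaLE [Finite α] {r : ℝ} {x : PresentedGroup R} {e : FreeGroup α}
    (h : Joins R r x x e) : AreaLE R (dehnFunction R ⌊r⌋₊) e := by
  obtain ⟨u, rfl, hu, hv⟩ := h
  exact areaLE_dehnFunction (Nat.le_floor hu) (hv.trans (inv_mul_cancel x))

/-- The class of a chosen shortest word that leads from `x` to `y`. -/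
def geodesic (x y : PresentedGroup R) : FreeGroup α :=
  FreeGroup.mk (exists_word R (x⁻¹ * y)).choose

theorem joins_geodesic (x y : PresentedGroup R) : Joins R (dist x y) x y (geodesic x y) := by
  have h := (exists_word R (x⁻¹ * y)).choose_spec
  exact ⟨_, rfl, by rw [h.1, dist_eq_wordLength], h.2⟩

theorem geodesic_self (x : PresentedGroup R) : geodesic x x = 1 := by
  have h := (exists_word R (x⁻¹ * x)).choose_spec.1
  have h0 : wordLength R (x⁻¹ * x) = 0 := by rw [inv_mul_cancel, wordLength_one]
  rw [geodesic, List.length_eq_zero_iff.1 (h.trans h0), FreeGroup.one_eq_mk]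

theorem Joins.mono {r s : ℝ} {x y : PresentedGroup R} {e : FreeGroup α} (h : Joins R r x y e)
    (hrs : r ≤ s) : Joins R s x y e := by
  obtain ⟨u, he, hu, hv⟩ := h
  exact ⟨u, he, hu.trans hrs, hv⟩

theorem Joins.dist_le {r : ℝ} {x y : PresentedGroup R} {e : FreeGroup α} (h : Joins R r x y e) :
    dist x y ≤ r := by
  obtain ⟨u, -, hu, hv⟩ := h
  rw [dist_eq_wordLength, ← hv]
  exact (Nat.cast_le.2 (wordLength_le R u)).trans hu

/-! ### The loop defined by a sequence of words -/

/-- The prefix of `w` whose length is the proportion `t` of the length of `w`, rounded down. -/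
def prefixWord (w : List (α × Bool)) (t : ℝ) : List (α × Bool) := w.take ⌊t * w.length⌋₊

theorem prefixWord_zero (w : List (α × Bool)) : prefixWord w 0 = [] := by
  simp [prefixWord]

theorem prefixWord_one (w : List (α × Bool)) : prefixWord w 1 = w := by
  simp [prefixWord]

/-- The part of `w` between two of its prefixes; the summand `1` comes from rounding. -/
theorem joins_prefixWord (w : List (α × Bool)) (x₀ : PresentedGroup R) {s t : ℝ} (hs : 0 ≤ s)
    (hst : s ≤ t) :
    Joins R ((t - s) * w.length + 1) (x₀ * wordValue R (prefixWord w s))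
      (x₀ * wordValue R (prefixWord w t))
      ((FreeGroup.mk (prefixWord w s))⁻¹ * FreeGroup.mk (prefixWord w t)) := by
  have hle : ⌊s * w.length⌋₊ ≤ ⌊t * w.length⌋₊ := Nat.floor_le_floor (by gcongr)
  have hsplit : prefixWord w s ++ (prefixWord w t).drop ⌊s * w.length⌋₊ = prefixWord w t := by
    have := List.take_append_drop ⌊s * w.length⌋₊ (prefixWord w t)
    rwa [prefixWord, List.take_take, min_eq_left hle] at this
  have hmk : FreeGroup.mk (prefixWord w s) * FreeGroup.mk ((prefixWord w t).drop ⌊s * w.length⌋₊) =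
      FreeGroup.mk (prefixWord w t) := by rw [FreeGroup.mul_mk, hsplit]
  refine ⟨(prefixWord w t).drop ⌊s * w.length⌋₊, eq_inv_mul_of_mul_eq hmk, ?_, ?_⟩
  · have h1 : ((prefixWord w t).drop ⌊s * w.length⌋₊).length ≤
        ⌊t * w.length⌋₊ - ⌊s * w.length⌋₊ := by
      rw [List.length_drop]
      exact Nat.sub_le_sub_right (List.length_take_le _ _) _
    have h2 : (((prefixWord w t).drop ⌊s * w.length⌋₊).length : ℝ) ≤
        (⌊t * w.length⌋₊ : ℝ) - ⌊s * w.length⌋₊ := by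
      rw [← Nat.cast_sub hle]
      exact_mod_cast h1
    have h3 : (⌊t * w.length⌋₊ : ℝ) ≤ t * w.length :=
      Nat.floor_le (mul_nonneg (hs.trans hst) (Nat.cast_nonneg _))
    have h4 := Nat.lt_floor_add_one (s * (w.length : ℝ))
    linarith
  · rw [wordValue, eq_inv_mul_of_mul_eq hmk, map_mul, map_inv, wordValue, wordValue]
    group

theorem dist_prefixWord_le (w : List (α × Bool)) (x₀ : PresentedGroup R) {s t : ℝ} (hs : 0 ≤ s)
    (ht : 0 ≤ t) :
    dist (x₀ * wordValue R (prefixWord w s)) (x₀ * wordValue R (prefixWord w t)) ≤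
      |s - t| * w.length + 1 := by
  rcases le_total s t with h | h
  · rw [abs_sub_comm, abs_of_nonneg (sub_nonneg.2 h)]
    exact (joins_prefixWord w x₀ hs h).dist_le
  · rw [dist_comm, abs_of_nonneg (sub_nonneg.2 h)]
    exact (joins_prefixWord w x₀ ht h).dist_le

variable {ω : Ultrafilter ℕ} {n : ℕ → ℕ} {x₀ : PresentedGroup R}

/-- The sequence of the endpoints of the prefixes of proportion `t`, read from the base point. -/
def prefixSeq {w : ℕ → List (α × Bool)} (hw : ∀ i, (w i).length ≤ n i) (t : ℝ) :
    ConeSeq ω (fun i => (n i : ℝ≥0)) x₀ :=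
  ⟨fun i => x₀ * wordValue R (prefixWord (w i) t), 1, fun i => by
    rw [dist_comm, dist_eq_wordLength, inv_mul_cancel_left, one_mul]
    have h1 := wordLength_le R (prefixWord (w i) t)
    have h2 : (prefixWord (w i) t).length ≤ (w i).length := List.length_take_le' _ _
    simpa using (h1.trans h2).trans (hw i)⟩

/-- The constant sequence at the base point. -/
def baseSeq (ω : Ultrafilter ℕ) (n : ℕ → ℕ) (x₀ : PresentedGroup R) :
    ConeSeq ω (fun i => (n i : ℝ≥0)) x₀ :=
  ⟨fun _ => x₀, 0, fun i => by simp⟩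

theorem prefixSeq_zero {w : ℕ → List (α × Bool)} (hw : ∀ i, (w i).length ≤ n i) :
    prefixSeq hw 0 = baseSeq ω n x₀ :=
  Subtype.ext (funext fun i => by
    change x₀ * wordValue R (prefixWord (w i) 0) = x₀
    rw [prefixWord_zero]
    exact mul_one x₀)

theorem prefixSeq_one {w : ℕ → List (α × Bool)} (hw : ∀ i, (w i).length ≤ n i)
    (hv : ∀ i, wordValue R (w i) = 1) : prefixSeq hw 1 = baseSeq ω n x₀ :=
  Subtype.ext (funext fun i => by
    change x₀ * wordValue R (prefixWord (w i) 1) = x₀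
    rw [prefixWord_one, hv, mul_one])

theorem NonPrincipal.le_atTop (hω : NonPrincipal ω) : (ω : Filter ℕ) ≤ atTop := by
  rw [← Nat.cofinite_eq_atTop]
  intro s hs
  exact Ultrafilter.compl_notMem_iff.1 (hω _ (mem_cofinite.1 hs))

theorem dist_prefixSeq_le (hn : Tendsto n ω atTop) {w : ℕ → List (α × Bool)}
    (hw : ∀ i, (w i).length ≤ n i) {s t : ℝ} (hs : 0 ≤ s) (ht : 0 ≤ t) :
    dist (prefixSeq hw s : ConeSeq ω (fun i => (n i : ℝ≥0)) x₀) (prefixSeq hw t) ≤ |s - t| := by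
  have hlim : Tendsto (fun i => |s - t| + (n i : ℝ)⁻¹) ω (𝓝 (|s - t| + 0)) :=
    tendsto_const_nhds.add (tendsto_inv_atTop_zero.comp (tendsto_natCast_atTop_atTop.comp hn))
  rw [add_zero] at hlim
  refine le_of_tendsto_of_tendsto (ConeSeq.tendsto_limDist _ _) hlim ?_
  filter_upwards [hn.eventually_gt_atTop 0] with i hi
  have hi' : (0 : ℝ) < n i := Nat.cast_pos.2 hi
  have h1 := dist_prefixWord_le (w i) x₀ hs ht
  have h2 : |s - t| * (w i).length ≤ |s - t| * n i := by
    gcongr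
    exact hw i
  change dist (x₀ * wordValue R (prefixWord (w i) s)) (x₀ * wordValue R (prefixWord (w i) t)) /
    (((n i : ℝ≥0) : ℝ)) ≤ _
  rw [NNReal.coe_natCast, div_le_iff₀ hi', add_mul, inv_mul_cancel₀ hi'.ne']
  linarith

/-- The loop of the cone that is the limit of the loops labelled by the words `w i`. -/
def prefixLoop (hn : Tendsto n ω atTop) {w : ℕ → List (α × Bool)}
    (hw : ∀ i, (w i).length ≤ n i) (hv : ∀ i, wordValue R (w i) = 1) :
    Path (SeparationQuotient.mk (baseSeq ω n x₀) : AsymptoticCone ω (fun i => (n i : ℝ≥0)) x₀)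
      (SeparationQuotient.mk (baseSeq ω n x₀)) where
  toFun t := SeparationQuotient.mk (prefixSeq hw t)
  continuous_toFun := by
    refine (LipschitzWith.of_dist_le_mul (K := 1) fun s t => ?_).continuous
    rw [NNReal.coe_one, one_mul, SeparationQuotient.dist_mk, Subtype.dist_eq, Real.dist_eq]
    exact dist_prefixSeq_le hn hw s.2.1 t.2.1
  source' := by rw [Set.Icc.coe_zero, prefixSeq_zero]
  target' := by rw [Set.Icc.coe_one, prefixSeq_one hw hv]

/-! ### Subdividing a null homotopy -/

open Classical in
/-- A lift of a map `H` from the square to the cone: the given lift `f` on the side where the first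
coordinate is `0`, and, off that side, the constant sequence wherever `H` takes the base point as
its value, so that edges of the grid on the other three sides get the trivial label. -/
def squareLift (f : ℝ → ConeSeq ω (fun i => (n i : ℝ≥0)) x₀)
    (H : unitInterval × unitInterval → AsymptoticCone ω (fun i => (n i : ℝ≥0)) x₀)
    (s t : unitInterval) : ConeSeq ω (fun i => (n i : ℝ≥0)) x₀ :=
  if s = 0 then f t
  else if H (s, t) = SeparationQuotient.mk (baseSeq ω n x₀) then baseSeq ω n x₀
  else Quotient.out (H (s, t))

theorem mk_squareLift {f : ℝ → ConeSeq ω (fun i => (n i : ℝ≥0)) x₀}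
    {H : unitInterval × unitInterval → AsymptoticCone ω (fun i => (n i : ℝ≥0)) x₀}
    (h0 : ∀ t : unitInterval, H (0, t) = SeparationQuotient.mk (f t)) (s t : unitInterval) :
    SeparationQuotient.mk (squareLift f H s t) = H (s, t) := by
  unfold squareLift
  split_ifs with h h'
  · rw [h, h0]
  · exact h'.symm
  · exact Quotient.out_eq (H (s, t))

/-- The point `a / N` of the unit interval; the point `1` if `a > N`. -/
def gridPoint (N a : ℕ) : unitInterval := Set.projIcc 0 1 zero_le_one ((a : ℝ) / N)

theorem gridPoint_zero (N : ℕ) : gridPoint N 0 = 0 := by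
  rw [gridPoint, Nat.cast_zero, zero_div]
  exact Set.projIcc_left zero_le_one

theorem gridPoint_self {N : ℕ} (hN : 0 < N) : gridPoint N N = 1 := by
  rw [gridPoint, div_self (Nat.cast_pos.2 hN).ne']
  exact Set.projIcc_right zero_le_one

theorem coe_gridPoint {N a : ℕ} (ha : a ≤ N) : (gridPoint N a : ℝ) = a / N := by
  have h : (a : ℝ) / N ∈ Set.Icc (0 : ℝ) 1 :=
    ⟨by positivity, div_le_one_of_le₀ (Nat.cast_le.2 ha) (Nat.cast_nonneg _)⟩
  rw [gridPoint, Set.projIcc_of_mem _ h]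

theorem coe_gridPoint_succ_sub {N a : ℕ} (ha : a < N) :
    (gridPoint N (a + 1) : ℝ) - gridPoint N a = 1 / N := by
  rw [coe_gridPoint ha, coe_gridPoint ha.le]
  push_cast
  ring

theorem dist_gridPoint_succ {N a : ℕ} (ha : a < N) :
    dist (gridPoint N a) (gridPoint N (a + 1)) = 1 / N := by
  rw [dist_comm, Subtype.dist_eq, Real.dist_eq, coe_gridPoint_succ_sub ha,
    abs_of_nonneg (by positivity)]

/-- If the loop of the words `w i` is contractible, then for `ω`-almost all `i` the word `w i`
is subdivided into a bounded number of loops of length at most `r * n i`. -/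
theorem exists_areaLE_of_homotopic [Finite α] (hn : Tendsto n ω atTop) {w : ℕ → List (α × Bool)}
    (hw : ∀ i, (w i).length ≤ n i) (hv : ∀ i, wordValue R (w i) = 1)
    (hH : (prefixLoop (x₀ := x₀) hn hw hv).Homotopic (Path.refl _)) {r : ℝ} (hr : 0 < r) :
    ∃ N : ℕ, ∀ᶠ i in (ω : Filter ℕ),
      AreaLE R (N * (N * dehnFunction R ⌊r * n i⌋₊)) (FreeGroup.mk (w i)) := by
  obtain ⟨H⟩ := hH
  have hε : 0 < r / 4 := by positivity
  obtain ⟨δ, hδ, hHδ⟩ := Metric.uniformContinuous_iff.1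
    (CompactSpace.uniformContinuous_of_continuous H.continuous) (r / 4) hε
  -- The cells have diameter less than `δ`, and the pieces of `w i` on the side that carries the
  -- loop have length at most `n i / N + 1 ≤ r / 4 * n i` for almost all `i`.
  obtain ⟨N, hNδ⟩ := exists_nat_one_div_lt (lt_min hδ (show 0 < r / 8 by positivity))
  obtain ⟨M, hM⟩ : ∃ M, M = N + 1 := ⟨_, rfl⟩
  rw [← Nat.cast_add_one, ← hM, lt_min_iff] at hNδ
  have hM0 : 0 < M := by omega
  refine ⟨M, ?_⟩
  obtain ⟨L, hL⟩ : ∃ L : ℕ → ℕ → ConeSeq ω (fun i => (n i : ℝ≥0)) x₀,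
    L = fun a b => squareLift (prefixSeq hw) H (gridPoint M a) (gridPoint M b) := ⟨_, rfl⟩
  have hmk : ∀ a b, SeparationQuotient.mk (L a b) = H (gridPoint M a, gridPoint M b) := by
    intro a b
    rw [hL]
    exact mk_squareLift (fun t => H.apply_zero t) _ _
  have hL0 : ∀ b, L 0 b = prefixSeq hw (gridPoint M b) := by
    intro b
    rw [hL]
    exact if_pos (gridPoint_zero M)
  have hbase : ∀ a b, 0 < a → a ≤ M →
      H (gridPoint M a, gridPoint M b) = SeparationQuotient.mk (baseSeq ω n x₀) →
      L a b = baseSeq ω n x₀ := by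
    intro a b ha haM h
    have hne : gridPoint M a ≠ 0 := by
      intro h0
      have h1 := coe_gridPoint haM
      rw [h0, Set.Icc.coe_zero] at h1
      have : (0 : ℝ) < (a : ℝ) / M := by positivity
      exact this.ne h1
    rw [hL]
    simp only [squareLift]
    rw [if_neg hne, if_pos h]
  have hLl : ∀ a ≤ M, L a 0 = baseSeq ω n x₀ := by
    intro a ha
    rcases a.eq_zero_or_pos with rfl | h
    · rw [hL0, gridPoint_zero, Set.Icc.coe_zero, prefixSeq_zero]
    · exact hbase a 0 h ha (by rw [gridPoint_zero]; exact H.source _)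
  have hLr : ∀ a ≤ M, L a M = baseSeq ω n x₀ := by
    intro a ha
    rcases a.eq_zero_or_pos with rfl | h
    · rw [hL0, gridPoint_self hM0, Set.Icc.coe_one, prefixSeq_one hw hv]
    · exact hbase a M h ha (by rw [gridPoint_self hM0]; exact H.target _)
  have hLt : ∀ b, L M b = baseSeq ω n x₀ := fun b =>
    hbase M b hM0 le_rfl (by rw [gridPoint_self hM0]; exact H.apply_one _)
  have hclose : ∀ {a b a' b' : ℕ},
      dist (gridPoint M a, gridPoint M b) (gridPoint M a', gridPoint M b') < δ →
      ∀ᶠ i in (ω : Filter ℕ), dist ((L a b).1 i) ((L a' b').1 i) ≤ r / 4 * n i := by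
    intro a b a' b' hd
    have h1 := hHδ hd
    rw [← hmk, ← hmk] at h1
    filter_upwards [(AsymptoticCone.tendsto_dist (L a b) (L a' b')).eventually_lt_const h1,
      hn.eventually_gt_atTop 0] with i hi hi0
    rw [NNReal.coe_natCast, div_lt_iff₀ (Nat.cast_pos.2 hi0)] at hi
    exact hi.le
  have hhor : ∀ᶠ i in (ω : Filter ℕ), ∀ a ∈ Set.Iic M, ∀ b ∈ Set.Iio M,
      dist ((L a b).1 i) ((L a (b + 1)).1 i) ≤ r / 4 * n i :=
    (eventually_all_finite (Set.finite_Iic M)).2 fun a _ =>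
      (eventually_all_finite (Set.finite_Iio M)).2 fun b hb => hclose (by
        rw [Prod.dist_eq, dist_self, dist_gridPoint_succ hb]
        exact max_lt hδ hNδ.1)
  have hver : ∀ᶠ i in (ω : Filter ℕ), ∀ a ∈ Set.Iio M, ∀ b ∈ Set.Iic M,
      dist ((L a b).1 i) ((L (a + 1) b).1 i) ≤ r / 4 * n i :=
    (eventually_all_finite (Set.finite_Iio M)).2 fun a ha =>
      (eventually_all_finite (Set.finite_Iic M)).2 fun b _ => hclose (by
        rw [Prod.dist_eq, dist_self, dist_gridPoint_succ ha]
        exact max_lt hNδ.1 hδ)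
  filter_upwards [hhor, hver,
    (tendsto_natCast_atTop_atTop.comp hn).eventually_ge_atTop (8 / r)] with i hh hv' hi
  -- On the side that carries the loop, the labels `(q b)⁻¹ * q (b + 1)` telescope to `w i`.
  obtain ⟨q, hq⟩ : ∃ q : ℕ → FreeGroup α,
    q = fun b => FreeGroup.mk (prefixWord (w i) (gridPoint M b)) := ⟨_, rfl⟩
  obtain ⟨h, hh_def⟩ : ∃ h : ℕ → ℕ → FreeGroup α, h = fun a b =>
    if a = 0 then (q b)⁻¹ * q (b + 1) else geodesic ((L a b).1 i) ((L a (b + 1)).1 i) := ⟨_, rfl⟩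
  obtain ⟨v, hv_def⟩ : ∃ v : ℕ → ℕ → FreeGroup α,
    v = fun a b => geodesic ((L a b).1 i) ((L (a + 1) b).1 i) := ⟨_, rfl⟩
  have hhJ : ∀ a ≤ M, ∀ b < M,
      Joins R (r / 4 * n i) ((L a b).1 i) ((L a (b + 1)).1 i) (h a b) := by
    intro a ha b hb
    rw [hh_def]
    rcases a.eq_zero_or_pos with rfl | ha0
    · have hsub := coe_gridPoint_succ_sub hb
      have hJ := joins_prefixWord (w i) x₀ (gridPoint M b).2.1
        (sub_nonneg.1 (hsub ▸ (by positivity : (0 : ℝ) ≤ 1 / M)))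
      simp only [if_true, hL0, hq]
      refine hJ.mono ?_
      rw [hsub]
      have h1 : 1 / (M : ℝ) * (w i).length ≤ r / 8 * n i :=
        mul_le_mul hNδ.2.le (Nat.cast_le.2 (hw i)) (Nat.cast_nonneg _) (by positivity)
      have h2 : 8 ≤ (n i : ℝ) * r := (div_le_iff₀ hr).1 hi
      linarith
    · simp only [if_neg ha0.ne']
      exact (joins_geodesic _ _).mono (hh a ha b hb)
  have hvJ : ∀ a < M, ∀ b ≤ M,
      Joins R (r / 4 * n i) ((L a b).1 i) ((L (a + 1) b).1 i) (v a b) := by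
    intro a ha b hb
    rw [hv_def]
    exact (joins_geodesic _ _).mono (hv' a ha b hb)
  have hgrid : AreaLE R (M * (M * dehnFunction R ⌊r * n i⌋₊)) (rowProd (h 0) M) := by
    refine AreaLE.grid (v := v) (fun a ha b hb => ?_) (fun a ha => ?_) (fun a ha => ?_)
      (fun b hb => ?_)
    · have := (((hhJ a ha.le b hb).trans (hvJ a ha (b + 1) hb)).trans
        (hhJ (a + 1) ha b hb).inv).trans (hvJ a ha b hb.le).inv
      exact (this.mono (by linarith : _ ≤ r * n i)).areaLE
    · rw [hv_def]
      simp only [hLl a ha.le, hLl (a + 1) ha, geodesic_self]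
    · rw [hv_def]
      simp only [hLr a ha.le, hLr (a + 1) ha, geodesic_self]
    · rw [hh_def]
      simp only [if_neg hM0.ne', hLt, geodesic_self]
  have htel : ∀ b, rowProd (h 0) b = (q 0)⁻¹ * q b := by
    intro b
    induction b with
    | zero => simp [rowProd]
    | succ b ih =>
      rw [rowProd_succ, ih, hh_def]
      simp only [if_true]
      group
  rw [htel, hq] at hgrid
  simpa only [gridPoint_zero, gridPoint_self hM0, Set.Icc.coe_zero, Set.Icc.coe_one,
    prefixWord_zero, prefixWord_one, ← FreeGroup.one_eq_mk, inv_one, one_mul] using hgrid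

end Area

end

end GroupCone

theorem mainTheorem3 {α : Type*} [Finite α] (R : Set (FreeGroup α)) (hR : R.Finite)
    (n : ℕ → ℕ) (hP2 : GroupCone.PropertyP2 (GroupCone.dehnFunction R) n)
    (ω : Ultrafilter ℕ) (hω : GroupCone.NonPrincipal ω) (x₀ : PresentedGroup R) :
    ¬ SimplyConnectedSpace (GroupCone.AsymptoticCone ω (fun i => (n i : ℝ≥0)) x₀) ∧
    ∃ (p : GroupCone.AsymptoticCone ω (fun i => (n i : ℝ≥0)) x₀) (γ : Path p p),
      ¬ γ.Homotopic (Path.refl p) := by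
  suffices hex : ∃ (p : GroupCone.AsymptoticCone ω (fun i => (n i : ℝ≥0)) x₀) (γ : Path p p),
      ¬ γ.Homotopic (Path.refl p) by
    refine ⟨fun hsc => ?_, hex⟩
    obtain ⟨p, γ, hγ⟩ := hex
    exact hγ (SimplyConnectedSpace.paths_homotopic γ (Path.refl p))
  obtain ⟨-, hn, hlarge, r, hr, c, hsmall⟩ := hP2
  have hnω : Tendsto n ω atTop := hn.mono_left hω.le_atTop
  choose w hw hv harea using fun i => (GroupCone.dehnFunction_isGreatest R (n i)).1
  refine ⟨_, GroupCone.prefixLoop (x₀ := x₀) hnω hw hv, fun hH => ?_⟩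
  obtain ⟨N, hN⟩ := GroupCone.exists_areaLE_of_homotopic hnω hw hv hH hr
  obtain ⟨i, hi, hi0, hlt⟩ := (hN.and ((hnω.eventually_gt_atTop 0).and
    ((hlarge.mono_left hω.le_atTop).eventually_gt_atTop (N * (N * c))))).exists
  have hle : (GroupCone.dehnFunction R (n i) : ℝ) ≤
      N * (N * GroupCone.dehnFunction R ⌊r * n i⌋₊) := by
    rw [harea i]
    exact_mod_cast hi.area_le
  have hdehn := hsmall i ⌊r * n i⌋₊ (Nat.floor_le (by positivity))
  have hpos : (0 : ℝ) < (n i : ℝ) ^ 2 := by positivity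
  rw [lt_div_iff₀ hpos] at hlt
  have hmul : (N : ℝ) * (N * GroupCone.dehnFunction R ⌊r * n i⌋₊) ≤
      N * (N * (c * (n i : ℝ) ^ 2)) := by gcongr
  linarith
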